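/- Let $n,s\ge 0$ and $f_1,\dots,f_s\in\mathbb{R}[x_1,\dots,x_n]$, let $F=(f_1,\dots,f_s):\mathbb{R}^n\to\mathbb{R}^s$, and denote also by $F:\mathbb{C}^n\to\mathbb{C}^s$ its complexification. For $e\in\mathbb{R}^s$ put $$H_e=[-e_1,e_1]\times\dots\times[-e_s,e_s]\quad(\text{where }[-a,a]\text{ means }[a,-a]\text{ if }a<0),$$ $$S_e=F^{-1}(H_e)=\{p\in\mathbb{R}^n : |f_i(p)|\le |e_i|\text{ for }1\le i\le s\}.$$ Let $\mathcal{W}(H_e)$ be the set of all products $I_1\times\dots\times I_s$ where each $I_i$ is $\{-e_i\}$, $\{e_i\}$ or the open interval with end points $-e_i$ and $e_i$, and let $\mathcal{W}(S_e)=\{F^{-1}(A) : A\in\mathcal{W}(H_e)\}$. For $I\subseteq\{1,\dots,s\}$ and $\sigma:I\to\{\pm1\}$ let $J_{I,\sigma}\subseteq\mathbb{R}[x_1,\dots,x_n]$ be the ideal generated by the polynomials $f_i-\sigma_ie_i$ for $i\in I$ and by the $\#I\times\#I$ minors of the $\#I\times n$ matrix $(\partial f_i/\partial x_j)_{i\in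 I,\,1\le j\le n}$, and let $$Y_{I,\sigma}=\{x\in\mathbb{C}^n : f_i(x)=\sigma_ie_i\text{ for all }i\in I,\text{ and } p_I\circ \mathrm{d}_xF:\mathbb{C}^n\to\mathbb{C}^I\text{ is not surjective}\},$$ where $p_I:\mathbb{C}^s\to\mathbb{C}^I$ keeps the coordinates with index in $I$. The algorithm CheckWhitneyStratification, on input $f_1,\dots,f_s$ and $e\in\mathbb{R}^s$, runs through all pairs $(I,\sigma)$ with $I\subseteq\{1,\dots,s\}$, $\#I\le n+1$ and $\sigma:I\to\{\pm1\}$; it returns false as soon as $J_{I,\sigma}\ne\langle1\rangle$ for one of them, and returns true if the loop ends without this. **Proposition.** 1. The algorithm returns true if $e$ is generic: there is a nonzero polynomial $P\in\mathbb{R}[y_1,\dots,y_s]$, depending only on $f_1,\dots,f_s$, such that the algorithm returns true for every $e\in\mathbb{R}^s$ with $P(e)\neq0$. 2. For every $e\in\mathbb{R}^s$, if the algorithm returns true, then $\mathcal{W}(S_e)$ is a Whitney stratification of $S_e$, that is, a locally finite partition of $S_e$ (empty members being disregarded) into smooth embedded submanifolds of $\mathbb{R}^n$ that satisfies the condition of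 the frontier and Whitney's conditions (a) and (b). 3. For every $e\in\mathbb{R}^s$ and all $I,\sigma$, the test of the algorithm detects emptiness of $Y_{I,\sigma}$: $J_{I,\sigma}=\langle1\rangle$ if and only if $Y_{I,\sigma}=\varnothing$. Hence the algorithm returns true if and only if $Y_{I,\sigma}=\varnothing$ for all $I,\sigma$ with $\#I\le n+1$, and this holds if and only if $Y_{I,\sigma}=\varnothing$ for all $I,\sigma$. -/

import Mathlib

open scoped ContDiff Topology

noncomputable section

namespace CheckWhitney

/-! ### Whitney stratifications of subsets of Euclidean space -/

section Stratifications

variable {n : ℕ}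

/-- `A` is a smooth embedded submanifold of `ℝⁿ` (possibly empty, possibly with components of
different dimensions): locally it is the zero set of a smooth submersion to some `ℝᵏ`. -/
def IsSubmanifold (A : Set (EuclideanSpace ℝ (Fin n))) : Prop :=
  ∀ x ∈ A, ∃ (k : ℕ) (U : Set (EuclideanSpace ℝ (Fin n)))
    (g : EuclideanSpace ℝ (Fin n) → Fin k → ℝ),
    IsOpen U ∧ x ∈ U ∧ ContDiffOn ℝ ∞ g U ∧
      (∀ z ∈ U, Function.Surjective (fderiv ℝ g z)) ∧
      A ∩ U = {z ∈ U | g z = 0}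

/-- The velocity vectors at `x` of the smooth curves contained in `A` and passing through `x`. -/
def velocities (A : Set (EuclideanSpace ℝ (Fin n))) (x : EuclideanSpace ℝ (Fin n)) :
    Set (EuclideanSpace ℝ (Fin n)) :=
  {v | ∃ γ : ℝ → EuclideanSpace ℝ (Fin n), ContDiffAt ℝ ∞ γ 0 ∧ γ 0 = x ∧
    (∀ᶠ t in 𝓝 (0 : ℝ), γ t ∈ A) ∧ HasDerivAt γ v 0}

/-- The tangent space of `A` at `x`. When `A` is a submanifold and `x ∈ A`, the velocity vectors
already form a linear subspace, so that taking the span adds nothing. -/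
def tangent (A : Set (EuclideanSpace ℝ (Fin n))) (x : EuclideanSpace ℝ (Fin n)) :
    Submodule ℝ (EuclideanSpace ℝ (Fin n)) :=
  Submodule.span ℝ (velocities A x)

/-- Convergence of a sequence of linear subspaces of `ℝⁿ` in the Grassmannian: convergence of the
orthogonal projections. -/
def SubspaceTendsto (T : ℕ → Submodule ℝ (EuclideanSpace ℝ (Fin n)))
    (τ : Submodule ℝ (EuclideanSpace ℝ (Fin n))) : Prop :=
  Filter.Tendsto (fun k => (T k).starProjection) Filter.atTop (𝓝 τ.starProjection)

/-- Whitney's condition (a) for the pair `(X, Y)`: limits of tangent spaces of `X` at points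
tending to `y ∈ Y` contain the tangent space of `Y` at `y`. -/
def WhitneyA (X Y : Set (EuclideanSpace ℝ (Fin n))) : Prop :=
  ∀ y ∈ Y, ∀ (x : ℕ → EuclideanSpace ℝ (Fin n)) (τ : Submodule ℝ (EuclideanSpace ℝ (Fin n))),
    (∀ k, x k ∈ X) → Filter.Tendsto x Filter.atTop (𝓝 y) →
    SubspaceTendsto (fun k => tangent X (x k)) τ → tangent Y y ≤ τ

/-- Whitney's condition (b) for the pair `(X, Y)`: if `xₖ ∈ X` and `yₖ ∈ Y` tend to the same point
`y ∈ Y`, the secant lines through `xₖ` and `yₖ` tend to a line `l` and the tangent spaces of `X`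
at `xₖ` tend to a subspace `τ`, then `l ⊆ τ`. -/
def WhitneyB (X Y : Set (EuclideanSpace ℝ (Fin n))) : Prop :=
  ∀ y ∈ Y, ∀ (x z : ℕ → EuclideanSpace ℝ (Fin n))
    (l τ : Submodule ℝ (EuclideanSpace ℝ (Fin n))),
    (∀ k, x k ∈ X) → (∀ k, z k ∈ Y) → (∀ k, x k ≠ z k) →
    Filter.Tendsto x Filter.atTop (𝓝 y) → Filter.Tendsto z Filter.atTop (𝓝 y) →
    SubspaceTendsto (fun k => Submodule.span ℝ {x k - z k}) l →
    SubspaceTendsto (fun k => tangent X (x k)) τ → l ≤ τ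

/-- `𝒮` is a Whitney stratification of `S ⊆ ℝⁿ`: a locally finite partition of `S` into smooth
submanifolds (empty members of `𝒮` are allowed and carry no condition) with the condition of the
frontier and Whitney's conditions (a) and (b). -/
structure IsWhitneyStratification (S : Set (EuclideanSpace ℝ (Fin n)))
    (𝒮 : Set (Set (EuclideanSpace ℝ (Fin n)))) : Prop where
  sUnion_eq : ⋃₀ 𝒮 = S
  disjoint : ∀ X ∈ 𝒮, ∀ Y ∈ 𝒮, X ≠ Y → Disjoint X Y
  locallyFinite : ∀ x ∈ S, ∃ U ∈ 𝓝 x, {A ∈ 𝒮 | (A ∩ U).Nonempty}.Finite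
  submanifold : ∀ A ∈ 𝒮, IsSubmanifold A
  frontier : ∀ X ∈ 𝒮, ∀ Y ∈ 𝒮, (Y ∩ closure X).Nonempty → Y ⊆ closure X
  whitneyA : ∀ X ∈ 𝒮, ∀ Y ∈ 𝒮, X ≠ Y → WhitneyA X Y
  whitneyB : ∀ X ∈ 𝒮, ∀ Y ∈ 𝒮, X ≠ Y → WhitneyB X Y

end Stratifications

/-! ### The hypercube, its facets and their pullback -/

section Pullback

variable {n s : ℕ}

/-- The hypercube `[-e₁, e₁] × ⋯ × [-eₛ, eₛ]`, where `[-a, a]` means `[a, -a]` if `a < 0`. -/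
def hypercube (e : Fin s → ℝ) : Set (Fin s → ℝ) :=
  Set.univ.pi fun i => Set.uIcc (-e i) (e i)

/-- The relative interiors of the facets of the hypercube: the products of sets `Iᵢ`, each of which
is `{-eᵢ}`, the open interval with end points `-eᵢ` and `eᵢ`, or `{eᵢ}`. -/
def facetStratification (e : Fin s → ℝ) : Set (Set (Fin s → ℝ)) :=
  {A | ∃ I : Fin s → Set ℝ,
    (∀ i, I i = {-e i} ∨ I i = Set.uIoo (-e i) (e i) ∨ I i = {e i}) ∧ A = Set.univ.pi I}

/-- The real polynomial map `F = (f₁, …, fₛ) : ℝⁿ → ℝˢ`. -/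
def realMap (f : Fin s → MvPolynomial (Fin n) ℝ) (x : EuclideanSpace ℝ (Fin n)) : Fin s → ℝ :=
  fun i => MvPolynomial.eval (fun j => x j) (f i)

/-- `S_e = {p ∈ ℝⁿ : |fᵢ(p)| ≤ |eᵢ| for all i}`. -/
def thickening (f : Fin s → MvPolynomial (Fin n) ℝ) (e : Fin s → ℝ) :
    Set (EuclideanSpace ℝ (Fin n)) :=
  {p | ∀ i, |realMap f p i| ≤ |e i|}

/-- The preimages under `F` of the strata of the hypercube. -/
def pullbackStratification (f : Fin s → MvPolynomial (Fin n) ℝ) (e : Fin s → ℝ) :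
    Set (Set (EuclideanSpace ℝ (Fin n))) :=
  (fun A => realMap f ⁻¹' A) '' facetStratification e

/-- The set `S_e` is the preimage of the hypercube. -/
theorem thickening_eq_preimage (f : Fin s → MvPolynomial (Fin n) ℝ) (e : Fin s → ℝ) :
    thickening f e = realMap f ⁻¹' hypercube e := by
  ext p
  refine forall_congr' fun i => ?_
  simp only [Set.mem_univ, forall_true_left]
  rw [Set.mem_uIcc]
  rcases abs_cases (e i) with h | h <;> rcases abs_cases (realMap f p i) with h' | h' <;> grind

end Pullback

/-! ### The complex varieties `Y_{I,σ}` -/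

section Varieties

variable {n s : ℕ}

/-- The complex polynomial map `F = (f₁, …, fₛ) : ℂⁿ → ℂˢ`. -/
def complexMap (f : Fin s → MvPolynomial (Fin n) ℝ) (x : Fin n → ℂ) : Fin s → ℂ :=
  fun i => MvPolynomial.aeval x (f i)

/-- The linear variety `L_{I,σ} = {y ∈ ℂˢ : yᵢ = σᵢ eᵢ for i ∈ I}`. -/
def linearVariety (e : Fin s → ℝ) (I : Finset (Fin s)) (σ : I → ℤˣ) : Set (Fin s → ℂ) :=
  {y | ∀ i : I, y i = ((σ i : ℤ) : ℂ) * ((e i : ℝ) : ℂ)}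

/-- The variety `Y_{I,σ}` of the `x ∈ ℂⁿ` such that `F(x) ∈ L_{I,σ}` and `p_I ∘ d_x F : ℂⁿ → ℂ^I`
is not surjective, where `p_I` keeps the coordinates with index in `I`. -/
def badVariety (f : Fin s → MvPolynomial (Fin n) ℝ) (e : Fin s → ℝ) (I : Finset (Fin s))
    (σ : I → ℤˣ) : Set (Fin n → ℂ) :=
  {x | complexMap f x ∈ linearVariety e I σ ∧
    ¬ Function.Surjective (fun (v : Fin n → ℂ) (i : I) => fderiv ℂ (complexMap f) x v i)}

end Varieties

/-! ### The algorithm -/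

section Algorithm

variable {n s : ℕ}

/-- The `#I × n` matrix `(∂fᵢ/∂xⱼ)`, with rows indexed by `I`. -/
def jacobian (f : Fin s → MvPolynomial (Fin n) ℝ) (I : Finset (Fin s)) :
    Matrix I (Fin n) (MvPolynomial (Fin n) ℝ) :=
  Matrix.of fun i j => MvPolynomial.pderiv j (f i)

/-- The ideal `⟨fᵢ - σᵢ eᵢ, i ∈ I⟩ + ⟨#I × #I minors of the Jacobian matrix⟩` of `ℝ[x₁, …, xₙ]`.
A minor is given by an injective choice of `#I` columns; the order of the columns only affects
its sign. -/
def testIdeal (f : Fin s → MvPolynomial (Fin n) ℝ) (e : Fin s → ℝ) (I : Finset (Fin s))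
    (σ : I → ℤˣ) : Ideal (MvPolynomial (Fin n) ℝ) :=
  Ideal.span (Set.range fun i : I => f i - MvPolynomial.C (((σ i : ℤ) : ℝ) * e i)) ⊔
    Ideal.span (Set.range fun c : I ↪ Fin n => ((jacobian f I).submatrix id c).det)

/-- The pairs `(I, σ)` visited by the loop: `I ⊆ {1, …, s}` with `#I ≤ n + 1` and
`σ : I → {±1}`. -/
def loopIndices (n s : ℕ) : List (Σ I : Finset (Fin s), (I → ℤˣ)) :=
  (Finset.univ.filter fun p : (Σ I : Finset (Fin s), (I → ℤˣ)) => p.1.card ≤ n + 1).toList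

open Classical in
/-- The algorithm: it runs through the pairs `(I, σ)`, returns `false` as soon as the ideal of one
of them is not the unit ideal, and returns `true` at the end of the loop otherwise. -/
def checkWhitneyStratification (f : Fin s → MvPolynomial (Fin n) ℝ) (e : Fin s → ℝ) : Bool :=
  (loopIndices n s).all fun p => decide (testIdeal f e p.1 p.2 = ⊤)

end Algorithm

end CheckWhitney

end

/-
A prime ideal `p` contains the maximal minors of the Jacobian matrix of `f_I` exactly when this
matrix drops rank over the residue field `κ(p)`. In characteristic zero the differentials of
algebraically independent elements are linearly independent over `κ(p)`, so the classes of the `fᵢ`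
then satisfy a polynomial relation; multiplying the relations over the finitely many minimal primes
gives an algebraic Sard theorem, whose polynomial vanishes at `(σᵢ eᵢ)` as soon as `Y_{I,σ}` is
nonempty. The tests detect emptiness by the Nullstellensatz, and for `#I > n` no map to `ℂ^I` is
surjective, so that `Y_{I,σ} ⊆ Y_{J,τ}` for a subset `J` of `I` of size `n + 1`.

If all `Y_{I,σ}` are empty, then `F` is transverse to all faces of the cube. The preimage of a face
is an open piece of a fibre `g⁻¹(q)` of some `g = p_I ∘ F` which is a submersion along the closure
of that preimage, so any stratum `Y` in this closure also lies in `g⁻¹(q)`. The tangent spaces of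
the piece are the kernels of `dg`, which vary continuously up to `Y`: they converge to a space
containing `T_y Y`, which is (a), and limits of secants of `g⁻¹(q)` are killed by `dg`, which is
(b).
-/

noncomputable section

namespace CheckWhitney

section MaximalMinors

variable {R K ι κ : Type*} [CommRing R] [Field K]

theorem surjective_mulVec_of_linearIndependent_row [Finite ι] [Fintype κ] {M : Matrix ι κ K}
    (hM : LinearIndependent K M.row) : Function.Surjective M.mulVec := by
  have := Fintype.ofFinite ι
  have : LinearMap.range M.mulVecLin = ⊤ := Submodule.eq_top_of_finrank_eq <| by
    rw [Module.finrank_fintype_fun_eq_card]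
    exact hM.rank_matrix
  exact LinearMap.range_eq_top.1 this

variable [Fintype ι] [DecidableEq ι]

/-- The ideal generated by the maximal minors of a matrix with rows indexed by `ι`. As in
`testIdeal`, a minor is given by an injective choice of columns. -/
def maximalMinorIdeal (M : Matrix ι κ R) : Ideal R :=
  Ideal.span (Set.range fun c : ι ↪ κ => (M.submatrix id c).det)

variable [Fintype κ]

theorem exists_det_submatrix_ne_zero {M : Matrix ι κ K} (hM : Function.Surjective M.mulVec) :
    ∃ c : ι ↪ κ, (M.submatrix id c).det ≠ 0 := by
  have span_cols : Submodule.span K (Set.range M.col) = ⊤ := by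
    rw [← Matrix.range_mulVecLin]
    exact LinearMap.range_eq_top.2 hM
  obtain ⟨α, a, ha, hspan, hli⟩ := exists_linearIndependent' K M.col
  have : Fintype α := @Fintype.ofFinite α (Finite.of_injective a ha)
  let b := Module.Basis.mk hli (hspan.trans span_cols).ge
  let φ : ι ≃ α := (Pi.basisFun K ι).indexEquiv b
  refine ⟨⟨a ∘ φ, ha.comp φ.injective⟩, IsUnit.ne_zero ?_⟩
  rw [← Matrix.isUnit_iff_isUnit_det, ← Matrix.linearIndependent_cols_iff_isUnit]
  exact hli.comp φ φ.injective

theorem surjective_mulVec_of_isUnit_det_submatrix {M : Matrix ι κ R} {c : ι → κ}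
    (hc : IsUnit (M.submatrix id c).det) : Function.Surjective M.mulVec := by
  classical
  refine Matrix.mulVec_surjective_iff_exists_right_inverse.2
    ⟨(1 : Matrix κ κ R).submatrix id c * (M.submatrix id c)⁻¹, ?_⟩
  have : M * (1 : Matrix κ κ R).submatrix id c = M.submatrix id c :=
    M.mul_submatrix_one (Equiv.refl κ) c
  rw [← Matrix.mul_assoc, this, Matrix.mul_nonsing_inv _ hc]

theorem maximalMinorIdeal_le_ker_iff (M : Matrix ι κ R) (φ : R →+* K) :
    maximalMinorIdeal M ≤ RingHom.ker φ ↔ ¬ Function.Surjective (M.map φ).mulVec := by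
  have map_minor (c : ι ↪ κ) : φ (M.submatrix id c).det = ((M.map φ).submatrix id c).det :=
    φ.map_det _
  rw [maximalMinorIdeal, Ideal.span_le, Set.range_subset_iff, ← not_iff_not, not_not]
  simp only [SetLike.mem_coe, RingHom.mem_ker, map_minor, not_forall]
  exact ⟨fun ⟨_, hc⟩ => surjective_mulVec_of_isUnit_det_submatrix (Ne.isUnit hc),
    exists_det_submatrix_ne_zero⟩

end MaximalMinors

section AlgebraicSard

theorem derivation_aeval {k A M σ : Type*} [CommSemiring k] [CommSemiring A] [Algebra k A]
    [AddCommMonoid M] [Module k M] [Module A M] [Fintype σ] (D : Derivation k A M)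
    (x : σ → A) (p : MvPolynomial σ k) :
    D (MvPolynomial.aeval x p) =
      ∑ j, MvPolynomial.aeval x (MvPolynomial.pderiv j p) • D (x j) := by
  classical
  induction p using MvPolynomial.induction_on with
  | C a => simp
  | add p q hp hq => simp [hp, hq, add_smul, Finset.sum_add_distrib]
  | mul_X p i hp =>
    simp [hp, MvPolynomial.pderiv_X, Pi.single_apply, add_smul, mul_smul, Finset.sum_add_distrib,
      ← Finset.smul_sum, apply_ite, ite_smul]

theorem linearIndependent_D_X_of_formallyEtale {k A σ : Type*} [CommRing k] [CommRing A]
    [Algebra k A] [Algebra (MvPolynomial σ k) A] [IsScalarTower k (MvPolynomial σ k) A]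
    [Algebra.FormallyEtale (MvPolynomial σ k) A] :
    LinearIndependent A fun i : σ =>
      KaehlerDifferential.D k A (algebraMap (MvPolynomial σ k) A (MvPolynomial.X i)) := by
  classical
  let b := ((KaehlerDifferential.mvPolynomialBasis k σ).baseChange A).map
    (KaehlerDifferential.tensorKaehlerEquivOfFormallyEtale k (MvPolynomial σ k) A)
  convert b.linearIndependent with i
  simp [b]

theorem formallyEtale_of_isAlgebraic (S L : Type*) [CommRing S] [Field L] [CharZero L]
    [Algebra S L] [FaithfulSMul S L] [Algebra.IsAlgebraic S L] : Algebra.FormallyEtale S L := by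
  have : IsDomain S := (FaithfulSMul.algebraMap_injective S L).isDomain (algebraMap S L)
  let : Algebra (FractionRing S) L := FractionRing.liftAlgebra S L
  have : CharZero (FractionRing S) := (algebraMap (FractionRing S) L).charZero
  have : Algebra.IsAlgebraic (FractionRing S) L :=
    (IsFractionRing.comap_isAlgebraic_iff (A := S)).1 inferInstance
  have : Algebra.FormallyEtale S (FractionRing S) := .of_isLocalization (nonZeroDivisors S)
  have : Algebra.FormallyEtale (FractionRing S) L := .of_isSeparable _ _
  exact .comp S (FractionRing S) L

/- A transcendence basis `t ⊇ range y` makes `L` formally étale over `k[t]`, so that the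
differentials of the elements of `t` are independent. -/
theorem linearIndependent_D_of_algebraicIndependent {k L ι : Type*} [Field k] [CharZero k]
    [Field L] [Algebra k L] {y : ι → L} (hy : AlgebraicIndependent k y) :
    LinearIndependent L fun i => KaehlerDifferential.D k L (y i) := by
  have : CharZero L := charZero_of_injective_algebraMap (algebraMap k L).injective
  obtain ⟨t, hyt, ht⟩ := exists_isTranscendenceBasis_superset
    ((algebraicIndependent_subtype_range hy.injective).2 hy)
  let : Algebra (MvPolynomial t k) L := (MvPolynomial.aeval ((↑) : t → L)).toAlgebra
  have : IsScalarTower k (MvPolynomial t k) L := .of_algHom _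
  have : FaithfulSMul (MvPolynomial t k) L := (faithfulSMul_iff_algebraMap_injective _ L).2 ht.1
  have : Algebra.IsAlgebraic (Algebra.adjoin k (Set.range ((↑) : t → L))) L := ht.isAlgebraic
  have : Algebra.IsAlgebraic (MvPolynomial t k) L :=
    .of_ringHom_of_comp_eq ht.1.aevalEquiv.toRingEquiv.toRingHom (RingHom.id L)
      ht.1.aevalEquiv.surjective Function.injective_id
      (RingHom.ext ht.1.algebraMap_aevalEquiv)
  have := formallyEtale_of_isAlgebraic (MvPolynomial t k) L
  have D_t := linearIndependent_D_X_of_formallyEtale (k := k) (A := L) (σ := t)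
  have aeval_X (i : t) : algebraMap (MvPolynomial t k) L (MvPolynomial.X i) = i :=
    MvPolynomial.aeval_X _ i
  simp only [aeval_X] at D_t
  exact D_t.comp (fun i => ⟨y i, hyt ⟨i, rfl⟩⟩) fun i j h => hy.injective (congrArg Subtype.val h)

/-- The Jacobian matrix of a family of polynomials over any coefficients and with any index type;
`jacobian f I` is `jacobianMatrix fun i : I => f i`. -/
def jacobianMatrix {k ι σ : Type*} [CommSemiring k] (f : ι → MvPolynomial σ k) :
    Matrix ι σ (MvPolynomial σ k) :=
  Matrix.of fun i j => MvPolynomial.pderiv j (f i)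

variable {k ι σ : Type*} [Field k] [CharZero k]

/- By the chain rule, the differentials of the `f i` at `x` are the images of the rows of the
Jacobian matrix under a linear map. -/
theorem surjective_jacobianMatrix_of_algebraicIndependent [Finite ι] [Fintype σ] {K : Type*}
    [Field K] [Algebra k K] {f : ι → MvPolynomial σ k} {x : σ → K}
    (h : AlgebraicIndependent k fun i => MvPolynomial.aeval x (f i)) :
    Function.Surjective ((jacobianMatrix f).map (MvPolynomial.aeval x)).mulVec := by
  have := Fintype.ofFinite ι
  have D_indep := linearIndependent_D_of_algebraicIndependent h
  simp only [derivation_aeval] at D_indep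
  exact surjective_mulVec_of_linearIndependent_row <|
    .of_comp (Fintype.linearCombination _ fun j => KaehlerDifferential.D k K (x j)) D_indep

variable [Fintype ι] [DecidableEq ι] [Finite σ]

theorem exists_ne_zero_aeval_mem_ker {K : Type*} [Field K] [Algebra k K] {f : ι → MvPolynomial σ k}
    {φ : MvPolynomial σ k →ₐ[k] K} (h : maximalMinorIdeal (jacobianMatrix f) ≤ RingHom.ker φ) :
    ∃ P : MvPolynomial ι k, P ≠ 0 ∧ MvPolynomial.aeval f P ∈ RingHom.ker φ := by
  have := Fintype.ofFinite σ
  by_contra! not_mem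
  rw [MvPolynomial.aeval_unique φ] at h not_mem
  refine (maximalMinorIdeal_le_ker_iff _ _).1 h
    (surjective_jacobianMatrix_of_algebraicIndependent (algebraicIndependent_iff.2 fun P hP => ?_))
  refine by_contra fun P_ne_zero => not_mem P P_ne_zero ?_
  rwa [RingHom.mem_ker, MvPolynomial.comp_aeval_apply]

theorem exists_ne_zero_aeval_mem_of_maximalMinorIdeal_le {f : ι → MvPolynomial σ k}
    {p : Ideal (MvPolynomial σ k)} [p.IsPrime] (hp : maximalMinorIdeal (jacobianMatrix f) ≤ p) :
    ∃ P : MvPolynomial ι k, P ≠ 0 ∧ MvPolynomial.aeval f P ∈ p := by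
  rw [← p.ker_algebraMap_residueField] at hp ⊢
  exact exists_ne_zero_aeval_mem_ker
    (φ := IsScalarTower.toAlgHom k (MvPolynomial σ k) p.ResidueField) hp

theorem exists_ne_zero_aeval_mem_radical_maximalMinorIdeal (f : ι → MvPolynomial σ k) :
    ∃ P : MvPolynomial ι k, P ≠ 0 ∧
      MvPolynomial.aeval f P ∈ (maximalMinorIdeal (jacobianMatrix f)).radical := by
  set J := maximalMinorIdeal (jacobianMatrix f)
  have finite_primes := Ideal.finite_minimalPrimes_of_isNoetherianRing _ J
  have exists_mem (p) (hp : p ∈ J.minimalPrimes) : ∃ P, P ≠ 0 ∧ MvPolynomial.aeval f P ∈ p :=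
    have := hp.1.1
    exists_ne_zero_aeval_mem_of_maximalMinorIdeal_le hp.1.2
  choose! P P_ne_zero aeval_P_mem using exists_mem
  refine ⟨∏ p ∈ finite_primes.toFinset, P p, Finset.prod_ne_zero_iff.2 fun p hp =>
    P_ne_zero p (finite_primes.mem_toFinset.1 hp), ?_⟩
  rw [← Ideal.sInf_minimalPrimes, Submodule.mem_sInf]
  intro p hp
  rw [map_prod]
  exact Ideal.mem_of_dvd p (Finset.dvd_prod_of_mem _ (finite_primes.mem_toFinset.2 hp))
    (aeval_P_mem p hp)

end AlgebraicSard

section Derivatives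

theorem hasFDerivAt_aeval {k 𝕜 σ : Type*} [CommSemiring k] [NontriviallyNormedField 𝕜]
    [Algebra k 𝕜] [Fintype σ] (p : MvPolynomial σ k) (x : σ → 𝕜) :
    HasFDerivAt (fun y : σ → 𝕜 => MvPolynomial.aeval y p)
      (∑ j, MvPolynomial.aeval x (MvPolynomial.pderiv j p) •
        (ContinuousLinearMap.proj j : (σ → 𝕜) →L[𝕜] 𝕜)) x := by
  classical
  induction p using MvPolynomial.induction_on with
  | C a =>
    simp only [MvPolynomial.aeval_C]
    exact (hasFDerivAt_const _ x).congr_fderiv (by ext; simp)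
  | add p q hp hq =>
    simp only [map_add]
    exact (hp.fun_add hq).congr_fderiv (by ext; simp [add_mul, Finset.sum_add_distrib])
  | mul_X p i hp =>
    simp only [map_mul, MvPolynomial.aeval_X]
    refine (hp.fun_mul (hasFDerivAt_apply i x)).congr_fderiv ?_
    ext
    simp [MvPolynomial.pderiv_X, Pi.single_apply, apply_ite, add_mul, mul_assoc,
      Finset.sum_add_distrib, Finset.mul_sum]

variable {n s : ℕ} (f : Fin s → MvPolynomial (Fin n) ℝ)

theorem fderiv_complexMap_apply (x v : Fin n → ℂ) :
    fderiv ℂ (complexMap f) x v =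
      ((jacobianMatrix f).map (MvPolynomial.aeval x)).mulVec v := by
  have : HasFDerivAt (complexMap f) _ x := hasFDerivAt_pi.2 fun i => hasFDerivAt_aeval (f i) x
  rw [this.fderiv]
  ext i
  simp [jacobianMatrix, Matrix.mulVec, dotProduct]

theorem fderiv_realMap_apply (x v : EuclideanSpace ℝ (Fin n)) :
    fderiv ℝ (realMap f) x v =
      ((jacobianMatrix f).map (MvPolynomial.aeval (x : Fin n → ℝ))).mulVec v := by
  have : HasFDerivAt (realMap f) _ x := hasFDerivAt_pi.2 fun i =>
    (hasFDerivAt_aeval (f i) (x : Fin n → ℝ)).comp x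
      (EuclideanSpace.equiv (Fin n) ℝ).hasFDerivAt
  rw [this.fderiv]
  ext i
  simp [jacobianMatrix, Matrix.mulVec, dotProduct]

theorem contDiff_realMap : ContDiff ℝ ∞ (realMap f) :=
  contDiff_pi.2 fun i => (AnalyticOnNhd.eval_mvPolynomial (f i)).contDiff.comp
    (EuclideanSpace.equiv (Fin n) ℝ).contDiff

end Derivatives

section Test

variable {n s : ℕ} {f : Fin s → MvPolynomial (Fin n) ℝ} {e : Fin s → ℝ} {I : Finset (Fin s)}
  {σ : I → ℤˣ}

theorem testIdeal_le_ker_aeval_iff {K : Type*} [Field K] [Algebra ℝ K] {x : Fin n → K} :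
    testIdeal f e I σ ≤ RingHom.ker (MvPolynomial.aeval x : _ →ₐ[ℝ] K) ↔
      (∀ i : I, MvPolynomial.aeval x (f i) = algebraMap ℝ K ((σ i : ℤ) * e i)) ∧
        ¬ Function.Surjective ((jacobian f I).map (MvPolynomial.aeval x)).mulVec := by
  refine sup_le_iff.trans (and_congr ?_ (maximalMinorIdeal_le_ker_iff _ _))
  simp [Ideal.span_le, Set.range_subset_iff, RingHom.mem_ker, sub_eq_zero]

theorem mem_badVariety_iff {x : Fin n → ℂ} :
    x ∈ badVariety f e I σ ↔
      testIdeal f e I σ ≤ RingHom.ker (MvPolynomial.aeval x : _ →ₐ[ℝ] ℂ) := by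
  rw [testIdeal_le_ker_aeval_iff]
  refine and_congr (by simp [linearVariety, complexMap]) (not_congr ?_)
  simp only [fderiv_complexMap_apply]
  rfl

theorem badVariety_eq_zeroLocus :
    badVariety f e I σ = MvPolynomial.zeroLocus ℂ (testIdeal f e I σ) :=
  Set.ext fun _ => mem_badVariety_iff

theorem testIdeal_eq_top_iff : testIdeal f e I σ = ⊤ ↔ badVariety f e I σ = ∅ := by
  rw [badVariety_eq_zeroLocus]
  refine ⟨fun h => h ▸ MvPolynomial.zeroLocus_top, fun h => ?_⟩
  rw [← Ideal.radical_eq_top, ← MvPolynomial.vanishingIdeal_zeroLocus_eq_radical (K := ℂ), h,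
    MvPolynomial.vanishingIdeal_empty]

theorem check_eq_true_iff :
    checkWhitneyStratification f e = true ↔
      ∀ (I : Finset (Fin s)) (σ : I → ℤˣ), I.card ≤ n + 1 → badVariety f e I σ = ∅ := by
  simp [checkWhitneyStratification, loopIndices, testIdeal_eq_top_iff, Sigma.forall]

theorem badVariety_eq_preimage_of_lt_card (hI : n < I.card) :
    badVariety f e I σ = complexMap f ⁻¹' linearVariety e I σ := by
  refine Set.ext fun x => and_iff_left fun h => hI.not_ge ?_
  simp only [fderiv_complexMap_apply] at h
  simpa using LinearMap.finrank_le_finrank_of_surjective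
    (f := ((jacobian f I).map (MvPolynomial.aeval x)).mulVecLin) h

theorem check_eq_true_iff_forall :
    checkWhitneyStratification f e = true ↔
      ∀ (I : Finset (Fin s)) (σ : I → ℤˣ), badVariety f e I σ = ∅ := by
  rw [check_eq_true_iff]
  refine ⟨fun h I σ => (le_or_gt I.card (n + 1)).elim (h I σ) fun hI => ?_,
    fun h I σ _ => h I σ⟩
  obtain ⟨J, hJI, hJ⟩ := Finset.exists_subset_card_eq hI.le
  have badVariety_J := h J (fun i => σ ⟨i, hJI i.2⟩) hJ.le
  rw [badVariety_eq_preimage_of_lt_card (by omega)] at badVariety_J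
  exact Set.subset_eq_empty (fun x hx (i : J) => hx.1 ⟨i, hJI i.2⟩) badVariety_J

end Test

section Generic

theorem exists_ne_zero_forall_eval_eq {R ι κ : Type*} [CommRing R] [IsDomain R] [Infinite R]
    {Q : MvPolynomial ι R} (hQ : Q ≠ 0) (u : ι → Rˣ) (c : ι ↪ κ) :
    ∃ P : MvPolynomial κ R, P ≠ 0 ∧
      ∀ e, MvPolynomial.eval e P = MvPolynomial.eval (fun i => u i * e (c i)) Q := by
  let P := MvPolynomial.aeval (fun i => MvPolynomial.C (u i : R) * MvPolynomial.X (c i)) Q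
  have eval_P (e : κ → R) :
      MvPolynomial.eval e P = MvPolynomial.eval (fun i => u i * e (c i)) Q := by
    simp only [P, ← MvPolynomial.aeval_eq_eval, MvPolynomial.comp_aeval_apply, map_mul,
      MvPolynomial.aeval_C, MvPolynomial.aeval_X, Algebra.algebraMap_self, RingHom.id_apply]
  obtain ⟨y, hy⟩ : ∃ y, MvPolynomial.eval y Q ≠ 0 := by
    by_contra! h
    exact hQ (MvPolynomial.funext fun y => by simp [h])
  refine ⟨P, fun hP => hy ?_, eval_P⟩
  simpa [hP, c.injective.extend_apply] using
    (eval_P (Function.extend c (fun i => ↑(u i)⁻¹ * y i) 0)).symm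

variable {n s : ℕ} {f : Fin s → MvPolynomial (Fin n) ℝ}

theorem eval_eq_zero_of_badVariety_nonempty {e : Fin s → ℝ} {I : Finset (Fin s)} {σ : I → ℤˣ}
    {Q : MvPolynomial I ℝ}
    (hQ : MvPolynomial.aeval (fun i : I => f i) Q ∈ (maximalMinorIdeal (jacobian f I)).radical)
    (h : (badVariety f e I σ).Nonempty) :
    MvPolynomial.eval (fun i : I => ((σ i : ℤ) : ℝ) * e i) Q = 0 := by
  obtain ⟨x, hx⟩ := h
  rw [mem_badVariety_iff] at hx
  have eval_f := (testIdeal_le_ker_aeval_iff.1 hx).1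
  have aeval_Q : MvPolynomial.aeval x (MvPolynomial.aeval (fun i : I => f i) Q) = 0 :=
    (RingHom.ker_isPrime _).radical_le_iff.2 (le_sup_right.trans hx) hQ
  rw [MvPolynomial.comp_aeval_apply] at aeval_Q
  simp only [eval_f] at aeval_Q
  exact (MvPolynomial.aeval_algebraMap_eq_zero_iff ℂ
    (fun i : I => ((σ i : ℤ) : ℝ) * e i) Q).1 aeval_Q

theorem exists_generic (f : Fin s → MvPolynomial (Fin n) ℝ) :
    ∃ P : MvPolynomial (Fin s) ℝ, P ≠ 0 ∧ ∀ e : Fin s → ℝ,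
      MvPolynomial.eval e P ≠ 0 → checkWhitneyStratification f e = true := by
  have exists_factor (p : Σ I : Finset (Fin s), (I → ℤˣ)) :
      ∃ P : MvPolynomial (Fin s) ℝ, P ≠ 0 ∧
        ∀ e, (badVariety f e p.1 p.2).Nonempty → MvPolynomial.eval e P = 0 := by
    obtain ⟨I, σ⟩ := p
    obtain ⟨Q, Q_ne_zero, hQ⟩ :=
      exists_ne_zero_aeval_mem_radical_maximalMinorIdeal fun i : I => f i
    obtain ⟨P, P_ne_zero, eval_P⟩ := exists_ne_zero_forall_eval_eq Q_ne_zero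
      (fun i => Units.map (Int.castRingHom ℝ) (σ i)) (.subtype (· ∈ I))
    exact ⟨P, P_ne_zero, fun e h => (eval_P e).trans (eval_eq_zero_of_badVariety_nonempty hQ h)⟩
  choose P P_ne_zero eval_P using exists_factor
  refine ⟨∏ p, P p, Finset.prod_ne_zero_iff.2 fun p _ => P_ne_zero p, fun e he => ?_⟩
  rw [map_prod, Finset.prod_ne_zero_iff] at he
  exact check_eq_true_iff_forall.2 fun I σ => Set.not_nonempty_iff_eq_empty.1 fun h =>
    he ⟨I, σ⟩ (Finset.mem_univ _) (eval_P ⟨I, σ⟩ e h)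

end Generic


section Submersions

open Filter

variable {E F : Type*} [NormedAddCommGroup E] [NormedSpace ℝ E]
  [NormedAddCommGroup F] [NormedSpace ℝ F]

theorem apply_eq_zero_of_tendsto_secant {α : Type*} {l : Filter α} [l.NeBot] {g : E → F}
    {g' : E →L[ℝ] F} {y v : E} {x z p : α → E} (hg : HasStrictFDerivAt g g' y)
    (hx : Tendsto x l (𝓝 y)) (hz : Tendsto z l (𝓝 y)) (hxz : ∀ k, g (x k) = g (z k))
    (hp : ∀ k, p k ∈ Submodule.span ℝ {x k - z k}) (hpv : Tendsto p l (𝓝 v)) : g' v = 0 := by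
  choose c hc using fun k => Submodule.mem_span_singleton.1 (hp k)
  have secant : (fun k => g' (x k - z k)) =o[l] fun k => x k - z k := by
    have := hg.isLittleO.comp_tendsto (hx.prodMk_nhds hz)
    simp only [Function.comp_def, hxz, sub_self, zero_sub] at this
    exact Asymptotics.isLittleO_neg_left.1 this
  have scaled : (fun k => g' (p k)) =o[l] p := by
    have := (Asymptotics.isBigO_refl c l).smul_isLittleO secant
    simpa only [← ContinuousLinearMap.map_smul, hc] using this
  have limit_zero : Tendsto (fun k => g' (p k)) l (𝓝 0) :=
    (Asymptotics.isLittleO_one_iff ℝ).1 (scaled.trans_isBigO (hpv.isBigO_one ℝ))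
  exact tendsto_nhds_unique ((g'.continuous.tendsto v).comp hpv) limit_zero

theorem contDiffAt_implicitFunctionOfComplemented [CompleteSpace E] [CompleteSpace F]
    {m : ℕ∞ω} {g : E → F} {g' : E →L[ℝ] F} {x : E} (hg : ContDiffAt ℝ m g x) (hm : m ≠ 0)
    (hg' : HasStrictFDerivAt g g' x) (range_eq : g'.range = ⊤) (compl : g'.ker.ClosedComplemented) :
    ContDiffAt ℝ m (hg'.implicitFunctionOfComplemented g g' range_eq compl (g x)) 0 := by
  let φ := hg'.implicitFunctionDataOfComplemented g g' range_eq compl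
  have smooth : ContDiffAt ℝ m φ.implicitFunction.uncurry (φ.prodFun x) :=
    φ.contDiffAt_implicitFunction hg
      (ContinuousLinearMap.contDiff _ |>.comp (contDiff_id.sub contDiff_const)).contDiffAt hm
  have prodFun_x : φ.prodFun x = (g x, 0) :=
    hg'.implicitToOpenPartialHomeomorphOfComplemented_self range_eq compl
  rw [prodFun_x] at smooth
  exact smooth.comp (f := fun u => (g x, u)) 0 (contDiffAt_const.prodMk contDiffAt_id)

variable [FiniteDimensional ℝ F]

theorem exists_forall_eventually_isUnit_comp {B : E →L[ℝ] F} (hB : Function.Surjective B) :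
    ∃ R : F →L[ℝ] E, B ∘L R = 1 ∧ ∀ᶠ A : E →L[ℝ] F in 𝓝 B, IsUnit (A ∘L R) := by
  have : CompleteSpace F := FiniteDimensional.complete ℝ F
  obtain ⟨R, hR⟩ := (B : E →ₗ[ℝ] F).exists_rightInverse_of_surjective (LinearMap.range_eq_top.2 hB)
  have comp_R : B ∘L LinearMap.toContinuousLinearMap R = 1 :=
    ContinuousLinearMap.ext (LinearMap.congr_fun hR)
  refine ⟨LinearMap.toContinuousLinearMap R, comp_R, ?_⟩
  have : ContinuousAt (fun A : E →L[ℝ] F => A ∘L LinearMap.toContinuousLinearMap R) B := by fun_prop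
  exact this.eventually_mem (Units.isOpen.mem_nhds (comp_R ▸ isUnit_one))

theorem isOpen_setOf_surjective : IsOpen {A : E →L[ℝ] F | Function.Surjective A} := by
  refine isOpen_iff_mem_nhds.2 fun B hB => ?_
  obtain ⟨R, -, isUnit_comp⟩ := exists_forall_eventually_isUnit_comp hB
  filter_upwards [isUnit_comp] with A hA
  have : Function.Surjective (A ∘ R) :=
    fun w => ⟨(hA.unit⁻¹ : (F →L[ℝ] F)ˣ).1 w, DFunLike.congr_fun hA.mul_val_inv w⟩
  exact this.of_comp

/- If `R` is a right inverse of `B`, then `v - R (A R)⁻¹ A v ∈ ker A` for `A` near `B`. -/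
theorem exists_tendsto_forall_eventually_mem_ker {B : E →L[ℝ] F} (hB : Function.Surjective B)
    {v : E} (hv : B v = 0) :
    ∃ w : (E →L[ℝ] F) → E, Tendsto w (𝓝 B) (𝓝 v) ∧ ∀ᶠ A in 𝓝 B, A (w A) = 0 := by
  have : CompleteSpace F := FiniteDimensional.complete ℝ F
  obtain ⟨R, comp_R, isUnit_comp⟩ := exists_forall_eventually_isUnit_comp hB
  refine ⟨fun A => v - R (Ring.inverse (A ∘L R) (A v)), ?_, ?_⟩
  · have inverse_continuousAt : ContinuousAt Ring.inverse (B ∘L R) := by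
      rw [comp_R]
      exact NormedRing.inverse_continuousAt 1
    have : ContinuousAt (fun A : E →L[ℝ] F => v - R (Ring.inverse (A ∘L R) (A v))) B :=
      continuousAt_const.sub <| R.continuous.continuousAt.comp <|
        (inverse_continuousAt.comp (f := fun A : E →L[ℝ] F => A ∘L R) (by fun_prop)).clm_apply
          (by fun_prop)
    simpa [ContinuousAt, hv] using this
  · filter_upwards [isUnit_comp] with A hA
    rw [map_sub, sub_eq_zero]
    exact (DFunLike.congr_fun (Ring.mul_inverse_cancel _ hA) (A v)).symm

theorem exists_contDiffAt_curve_of_mem_ker [CompleteSpace E] {m : ℕ∞ω} {g : E → F} {x v : E}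
    (hg : ContDiffAt ℝ m g x) (hm : m ≠ 0) (hgx : Function.Surjective (fderiv ℝ g x))
    (hv : fderiv ℝ g x v = 0) :
    ∃ γ : ℝ → E, ContDiffAt ℝ m γ 0 ∧ γ 0 = x ∧ (∀ᶠ t in 𝓝 0, g (γ t) = g x) ∧
      HasDerivAt γ v 0 := by
  have : CompleteSpace F := FiniteDimensional.complete ℝ F
  have strict := hg.hasStrictFDerivAt hm
  have range_eq : (fderiv ℝ g x).range = ⊤ := LinearMap.range_eq_top.2 hgx
  have compl := (fderiv ℝ g x).ker_closedComplemented_of_finiteDimensional_range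
  let ψ := strict.implicitFunctionOfComplemented g (fderiv ℝ g x) range_eq compl (g x)
  let c (t : ℝ) : (fderiv ℝ g x).ker := t • ⟨v, hv⟩
  have c_zero : c 0 = 0 := zero_smul ℝ _
  have hc : ContDiff ℝ m c := contDiff_id.smul contDiff_const
  have c_tendsto : Tendsto (fun t => (g x, c t)) (𝓝 0) (𝓝 (g x, 0)) :=
    tendsto_const_nhds.prodMk_nhds (c_zero ▸ hc.continuous.tendsto 0)
  refine ⟨ψ ∘ c, .comp 0 (c_zero ▸ contDiffAt_implicitFunctionOfComplemented hg hm ..)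
    hc.contDiffAt, ?_, c_tendsto.eventually <| strict.map_implicitFunctionOfComplemented_eq .., ?_⟩
  · rw [Function.comp_apply, c_zero]
    exact strict.implicitFunctionOfComplemented_apply_image ..
  · have hψ : HasFDerivAt ψ (fderiv ℝ g x).ker.subtypeL (c 0) :=
      c_zero ▸ (strict.to_implicitFunctionOfComplemented ..).hasFDerivAt
    simpa using hψ.comp_hasDerivAt 0 ((hasDerivAt_id 0).smul_const _)

end Submersions

section TangentSpaces

open Filter

variable {n : ℕ} {F : Type*} [NormedAddCommGroup F] [NormedSpace ℝ F]

section Grassmannian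

variable {T : ℕ → Submodule ℝ (EuclideanSpace ℝ (Fin n))}
  {τ : Submodule ℝ (EuclideanSpace ℝ (Fin n))} {v : ℕ → EuclideanSpace ℝ (Fin n)}
  {v₀ : EuclideanSpace ℝ (Fin n)}

theorem SubspaceTendsto.starProjection_apply (hT : SubspaceTendsto T τ)
    (hv : Tendsto v atTop (𝓝 v₀)) :
    Tendsto (fun k => (T k).starProjection (v k)) atTop (𝓝 (τ.starProjection v₀)) := by
  have pair_tendsto := Tendsto.prodMk_nhds hT hv
  exact ((continuous_fst.clm_apply continuous_snd).tendsto _).comp pair_tendsto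

theorem SubspaceTendsto.mem_of_tendsto (hT : SubspaceTendsto T τ) (hv : ∀ᶠ k in atTop, v k ∈ T k)
    (hv₀ : Tendsto v atTop (𝓝 v₀)) : v₀ ∈ τ := by
  have projection_eq : (fun k => (T k).starProjection (v k)) =ᶠ[atTop] v :=
    hv.mono fun _ => Submodule.starProjection_eq_self_iff.2
  rw [← Submodule.starProjection_eq_self_iff]
  exact tendsto_nhds_unique ((hT.starProjection_apply hv₀).congr' projection_eq) hv₀

end Grassmannian

theorem tangent_le_ker_fderiv {g : EuclideanSpace ℝ (Fin n) → F}
    {A : Set (EuclideanSpace ℝ (Fin n))} {x : EuclideanSpace ℝ (Fin n)}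
    (hg : DifferentiableAt ℝ g x) (hA : A ⊆ g ⁻¹' {g x}) :
    tangent A x ≤ (fderiv ℝ g x).ker := by
  refine Submodule.span_le.2 ?_
  rintro v ⟨γ, -, rfl, γ_mem, hγ⟩
  have g_γ : g ∘ γ =ᶠ[𝓝 0] fun _ => g (γ 0) := γ_mem.mono fun _ ht => hA ht
  exact (hg.hasFDerivAt.comp_hasDerivAt 0 hγ).unique
    ((hasDerivAt_const 0 _).congr_of_eventuallyEq g_γ)

variable [FiniteDimensional ℝ F]

theorem ker_fderiv_le_tangent {g : EuclideanSpace ℝ (Fin n) → F}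
    {U : Set (EuclideanSpace ℝ (Fin n))} {x : EuclideanSpace ℝ (Fin n)} (hg : ContDiffAt ℝ ∞ g x)
    (hgx : Function.Surjective (fderiv ℝ g x)) (hU : U ∈ 𝓝 x) :
    (fderiv ℝ g x).ker ≤ tangent (g ⁻¹' {g x} ∩ U) x := by
  intro v hv
  obtain ⟨γ, γ_smooth, γ_zero, g_γ, hγ⟩ :=
    exists_contDiffAt_curve_of_mem_ker hg (by simp) hgx hv
  refine Submodule.subset_span ⟨γ, γ_smooth, γ_zero, g_γ.and ?_, hγ⟩
  exact γ_smooth.continuousAt.eventually_mem (γ_zero ▸ hU)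

variable {g : EuclideanSpace ℝ (Fin n) → F} {q : F} {U Y : Set (EuclideanSpace ℝ (Fin n))}

theorem ker_fderiv_le_of_subspaceTendsto {x : ℕ → EuclideanSpace ℝ (Fin n)}
    {y : EuclideanSpace ℝ (Fin n)} {τ : Submodule ℝ (EuclideanSpace ℝ (Fin n))}
    (hg : ContDiff ℝ ∞ g) (hU : IsOpen U) (hgy : Function.Surjective (fderiv ℝ g y))
    (hx : ∀ k, x k ∈ g ⁻¹' {q} ∩ U) (hxy : Tendsto x atTop (𝓝 y))
    (hτ : SubspaceTendsto (fun k => tangent (g ⁻¹' {q} ∩ U) (x k)) τ) :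
    (fderiv ℝ g y).ker ≤ τ := by
  intro v hv
  have fderiv_tendsto : Tendsto (fun k => fderiv ℝ g (x k)) atTop (𝓝 (fderiv ℝ g y)) :=
    ((hg.continuous_fderiv (by simp)).tendsto y).comp hxy
  obtain ⟨w, w_tendsto, w_mem⟩ := exists_tendsto_forall_eventually_mem_ker hgy hv
  refine hτ.mem_of_tendsto ?_ (w_tendsto.comp fderiv_tendsto)
  filter_upwards [fderiv_tendsto.eventually w_mem,
    fderiv_tendsto.eventually_mem (isOpen_setOf_surjective.mem_nhds hgy)] with k w_mem_k hgx
  have := ker_fderiv_le_tangent hg.contDiffAt hgx (hU.mem_nhds (hx k).2) w_mem_k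
  rwa [(hx k).1] at this

theorem whitneyA_levelSet_inter (hg : ContDiff ℝ ∞ g) (hU : IsOpen U) (hY : Y ⊆ g ⁻¹' {q})
    (hgY : ∀ y ∈ Y, Function.Surjective (fderiv ℝ g y)) : WhitneyA (g ⁻¹' {q} ∩ U) Y := by
  intro y hy x τ hx hxy hτ
  have : Y ⊆ g ⁻¹' {g y} := by rwa [hY hy]
  exact (tangent_le_ker_fderiv (hg.differentiable (by simp) y) this).trans
    (ker_fderiv_le_of_subspaceTendsto hg hU (hgY y hy) hx hxy hτ)

theorem whitneyB_levelSet_inter (hg : ContDiff ℝ ∞ g) (hU : IsOpen U) (hY : Y ⊆ g ⁻¹' {q})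
    (hgY : ∀ y ∈ Y, Function.Surjective (fderiv ℝ g y)) : WhitneyB (g ⁻¹' {q} ∩ U) Y := by
  intro y hy x z l τ hx hz _ hxy hzy hl hτ v hv
  have projection_tendsto := hl.starProjection_apply (tendsto_const_nhds (x := v))
  rw [Submodule.starProjection_eq_self_iff.2 hv] at projection_tendsto
  refine ker_fderiv_le_of_subspaceTendsto hg hU (hgY y hy) hx hxy hτ ?_
  exact apply_eq_zero_of_tendsto_secant (hg.contDiffAt.hasStrictFDerivAt (by simp)) hxy hzy
    (fun k => (hx k).1.trans (hY (hz k)).symm) (fun k => Submodule.starProjection_apply_mem _ v)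
    projection_tendsto

theorem isSubmanifold_levelSet_inter (hg : ContDiff ℝ ∞ g) (hU : IsOpen U)
    (hgU : ∀ x ∈ g ⁻¹' {q} ∩ U, Function.Surjective (fderiv ℝ g x)) :
    IsSubmanifold (g ⁻¹' {q} ∩ U) := by
  intro x hx
  let φ : F ≃L[ℝ] (Fin (Module.finrank ℝ F) → ℝ) := .ofFinrankEq (by simp)
  refine ⟨_, U ∩ fderiv ℝ g ⁻¹' {A | Function.Surjective A}, fun z => φ (g z - q),
    hU.inter (isOpen_setOf_surjective.preimage (hg.continuous_fderiv (by simp))),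
    ⟨hx.2, hgU x hx⟩, (φ.contDiff.comp (hg.sub contDiff_const)).contDiffOn, ?_, ?_⟩
  · intro z hz
    have : HasFDerivAt (fun z => φ (g z - q)) (φ ∘L fderiv ℝ g z) z :=
      φ.hasFDerivAt.comp z ((hg.differentiable (by simp) z).hasFDerivAt.sub_const q)
    rw [this.fderiv]
    exact φ.surjective.comp hz.2
  · ext z
    simp only [Set.mem_inter_iff, Set.mem_preimage, Set.mem_singleton_iff, Set.mem_ofPred_eq,
      map_eq_zero_iff φ φ.injective, sub_eq_zero]
    tauto

theorem whitneyA_of_nonempty_inter_closure {X Y : Set (EuclideanSpace ℝ (Fin n))}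
    (h : (Y ∩ closure X).Nonempty → WhitneyA X Y) : WhitneyA X Y :=
  fun y hy x τ hx hxy =>
    h ⟨y, hy, mem_closure_of_tendsto hxy (.of_forall hx)⟩ y hy x τ hx hxy

theorem whitneyB_of_nonempty_inter_closure {X Y : Set (EuclideanSpace ℝ (Fin n))}
    (h : (Y ∩ closure X).Nonempty → WhitneyB X Y) : WhitneyB X Y :=
  fun y hy x z l τ hx hz hxz hxy =>
    h ⟨y, hy, mem_closure_of_tendsto hxy (.of_forall hx)⟩ y hy x z l τ hx hz hxz hxy

end TangentSpaces

section CubeFaces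

/-- The face of the interval with end points `-a` and `a` singled out by a sign: its interior for
`0`, and the end point `±a` for `±1`. If `a = 0`, the interior is empty. -/
def intervalFace (a : ℝ) (σ : SignType) : Set ℝ :=
  if σ = 0 then Set.uIoo (-a) a else {(σ : ℝ) * a}

section Interval

variable {a y : ℝ} {σ τ : SignType}

theorem mem_uIoo_neg_self_iff : y ∈ Set.uIoo (-a) a ↔ |y| < |a| := by
  rcases le_total 0 a with ha | ha
  · rw [Set.uIoo_of_le (by linarith), abs_of_nonneg ha, abs_lt, Set.mem_Ioo]
  · rw [Set.uIoo_of_ge (by linarith), abs_of_nonpos ha, abs_lt, Set.mem_Ioo, neg_neg]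

theorem mem_uIcc_neg_self_iff : y ∈ Set.uIcc (-a) a ↔ |y| ≤ |a| := by
  rcases le_total 0 a with ha | ha
  · rw [Set.uIcc_of_le (by linarith), abs_of_nonneg ha, abs_le, Set.mem_Icc]
  · rw [Set.uIcc_of_ge (by linarith), abs_of_nonpos ha, abs_le, Set.mem_Icc, neg_neg]

theorem intervalFace_zero : intervalFace a 0 = Set.uIoo (-a) a := if_pos rfl

theorem intervalFace_of_ne_zero (hσ : σ ≠ 0) : intervalFace a σ = {(σ : ℝ) * a} := if_neg hσ

theorem abs_eq_of_mem_intervalFace (hσ : σ ≠ 0) (hy : y ∈ intervalFace a σ) : |y| = |a| := by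
  rw [intervalFace_of_ne_zero hσ, Set.mem_singleton_iff] at hy
  cases σ <;> simp_all

theorem intervalFace_subset_uIcc : intervalFace a σ ⊆ Set.uIcc (-a) a := by
  intro y hy
  by_cases hσ : σ = 0
  · exact Set.uIoo_subset_uIcc_self (by rwa [hσ, intervalFace_zero] at hy)
  · exact mem_uIcc_neg_self_iff.2 (abs_eq_of_mem_intervalFace hσ hy).le

theorem iUnion_intervalFace : ⋃ σ, intervalFace a σ = Set.uIcc (-a) a := by
  refine (Set.iUnion_subset fun _ => intervalFace_subset_uIcc).antisymm fun y hy => ?_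
  rw [Set.mem_iUnion]
  rcases (mem_uIcc_neg_self_iff.1 hy).lt_or_eq with hlt | heq
  · exact ⟨0, by rwa [intervalFace_zero, mem_uIoo_neg_self_iff]⟩
  rcases abs_eq_abs.1 heq with rfl | rfl
  · exact ⟨1, by simp [intervalFace]⟩
  · exact ⟨-1, by simp [intervalFace]⟩

theorem closure_intervalFace_of_ne_zero (hσ : σ ≠ 0) :
    closure (intervalFace a σ) = intervalFace a σ := by
  rw [intervalFace_of_ne_zero hσ, closure_singleton]

theorem closure_intervalFace_subset_uIcc : closure (intervalFace a σ) ⊆ Set.uIcc (-a) a :=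
  closure_minimal intervalFace_subset_uIcc isClosed_Icc

theorem ne_zero_of_mem_intervalFace (hy : y ∈ intervalFace a σ) (h : |y| = |a|) : σ ≠ 0 := by
  rintro rfl
  rw [intervalFace_zero, mem_uIoo_neg_self_iff] at hy
  exact hy.ne h

theorem intervalFace_eq_of_mem_of_ne_zero (hσ : σ ≠ 0) (hy : y ∈ intervalFace a σ)
    (hyτ : y ∈ intervalFace a τ) : intervalFace a τ = intervalFace a σ := by
  have hτ : τ ≠ 0 := ne_zero_of_mem_intervalFace hyτ (abs_eq_of_mem_intervalFace hσ hy)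
  rw [intervalFace_of_ne_zero hσ] at hy ⊢
  rw [intervalFace_of_ne_zero hτ] at hyτ ⊢
  rw [← Set.mem_singleton_iff.1 hy, ← Set.mem_singleton_iff.1 hyτ]

theorem intervalFace_eq_of_mem (hσ : y ∈ intervalFace a σ) (hτ : y ∈ intervalFace a τ) :
    intervalFace a σ = intervalFace a τ := by
  by_cases hτ₀ : τ = 0
  · by_cases hσ₀ : σ = 0
    · rw [hσ₀, hτ₀]
    · exact (intervalFace_eq_of_mem_of_ne_zero hσ₀ hσ hτ).symm
  · exact intervalFace_eq_of_mem_of_ne_zero hτ₀ hτ hσ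

theorem intervalFace_subset_closure (h : (intervalFace a τ ∩ closure (intervalFace a σ)).Nonempty) :
    intervalFace a τ ⊆ closure (intervalFace a σ) := by
  obtain ⟨y, hyτ, hyσ⟩ := h
  by_cases hσ : σ = 0
  · have hne : (intervalFace a σ).Nonempty := closure_nonempty_iff.1 ⟨y, hyσ⟩
    rw [hσ, intervalFace_zero] at hne ⊢
    rw [closure_uIoo fun h => by simp [h] at hne]
    exact intervalFace_subset_uIcc
  · rw [closure_intervalFace_of_ne_zero hσ] at hyσ ⊢
    exact (intervalFace_eq_of_mem hyτ hyσ).subset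

end Interval

variable {ι : Type*} {e : ι → ℝ} {c d : ι → SignType}

/-- The face of the cube `∏ [-eᵢ, eᵢ]` given by a sign vector; these are the members of
`facetStratification e`, with repetitions if some `eᵢ` vanishes. -/
def cubeFace (e : ι → ℝ) (c : ι → SignType) : Set (ι → ℝ) :=
  Set.univ.pi fun i => intervalFace (e i) (c i)

theorem closure_cubeFace :
    closure (cubeFace e c) = Set.univ.pi fun i => closure (intervalFace (e i) (c i)) :=
  closure_pi_set _ _

theorem cubeFace_eq_of_mem {y : ι → ℝ} (hc : y ∈ cubeFace e c) (hd : y ∈ cubeFace e d) :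
    cubeFace e c = cubeFace e d :=
  Set.pi_congr rfl fun i hi => intervalFace_eq_of_mem (hc i hi) (hd i hi)

theorem cubeFace_subset_closure (h : (cubeFace e d ∩ closure (cubeFace e c)).Nonempty) :
    cubeFace e d ⊆ closure (cubeFace e c) := by
  rw [closure_cubeFace] at h ⊢
  obtain ⟨y, hyd, hyc⟩ := h
  exact Set.pi_mono fun i hi => intervalFace_subset_closure ⟨y i, hyd i hi, hyc i hi⟩

theorem iUnion_cubeFace {s : ℕ} (e : Fin s → ℝ) : ⋃ c, cubeFace e c = hypercube e := by
  simp only [cubeFace, Set.iUnion_univ_pi, iUnion_intervalFace, hypercube]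

theorem range_intervalFace (a : ℝ) :
    Set.range (intervalFace a) = {{-a}, Set.uIoo (-a) a, {a}} := by
  ext A
  constructor
  · rintro ⟨σ, rfl⟩
    cases σ <;> simp [intervalFace]
  · rintro (rfl | rfl | rfl)
    exacts [⟨-1, by simp [intervalFace]⟩, ⟨0, intervalFace_zero⟩, ⟨1, by simp [intervalFace]⟩]

theorem facetStratification_eq_range {s : ℕ} (e : Fin s → ℝ) :
    facetStratification e = Set.range (cubeFace e) := by
  ext A
  constructor
  · rintro ⟨I, hI, rfl⟩
    have mem_range (i : Fin s) : I i ∈ Set.range (intervalFace (e i)) := by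
      rw [range_intervalFace]
      exact hI i
    choose c hc using mem_range
    exact ⟨c, Set.pi_congr rfl fun i _ => hc i⟩
  · rintro ⟨c, rfl⟩
    refine ⟨_, fun i => ?_, rfl⟩
    have := Set.mem_range_self (f := intervalFace (e i)) (c i)
    rwa [range_intervalFace] at this

theorem abs_eq_of_mem_closure_cubeFace {y : ι → ℝ} (hy : y ∈ closure (cubeFace e c)) {i : ι}
    (hi : c i ≠ 0) : |y i| = |e i| := by
  rw [closure_cubeFace] at hy
  exact abs_eq_of_mem_intervalFace hi ((closure_intervalFace_of_ne_zero hi).subset (hy i trivial))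

theorem abs_le_of_mem_closure_cubeFace {y : ι → ℝ} (hy : y ∈ closure (cubeFace e c)) (i : ι) :
    |y i| ≤ |e i| := by
  rw [closure_cubeFace] at hy
  exact mem_uIcc_neg_self_iff.1 (closure_intervalFace_subset_uIcc (hy i trivial))

theorem preimage_cubeFace_subset_preimage_closure {X : Type*} [TopologicalSpace X]
    {F : X → ι → ℝ} (hF : Continuous F)
    (h : (F ⁻¹' cubeFace e d ∩ closure (F ⁻¹' cubeFace e c)).Nonempty) :
    F ⁻¹' cubeFace e d ⊆ F ⁻¹' closure (cubeFace e c) := by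
  obtain ⟨x, hxd, hxc⟩ := h
  exact Set.preimage_mono (cubeFace_subset_closure ⟨F x, hxd, hF.closure_preimage_subset _ hxc⟩)

/-- The coordinate projection `p_I : ℝ^ι → ℝ^I`. -/
def coordProj (I : Finset ι) : (ι → ℝ) →L[ℝ] (I → ℝ) :=
  ContinuousLinearMap.pi fun i => ContinuousLinearMap.proj (i : ι)

theorem coordProj_eq_iff {I : Finset ι} {y z : ι → ℝ} :
    coordProj I y = coordProj I z ↔ ∀ i ∈ I, y i = z i := by
  simp [coordProj, funext_iff]

/-- The points of `ℝ^ι` whose coordinates with index outside `I` lie in the open intervals with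
end points `-eᵢ` and `eᵢ`. -/
def openSlab (e : ι → ℝ) (I : Finset ι) : Set (ι → ℝ) :=
  {y | ∀ i ∉ I, |y i| < |e i|}

theorem isOpen_openSlab [Finite ι] (e : ι → ℝ) (I : Finset ι) : IsOpen (openSlab e I) := by
  simp only [openSlab, Set.ofPred_forall]
  exact isOpen_iInter_of_finite fun i => isOpen_iInter_of_finite fun _ =>
    isOpen_lt (continuous_apply i).abs continuous_const

variable [Fintype ι]

/-- The indices of the coordinates that are constant on the face given by a sign vector. -/
def activeSet (c : ι → SignType) : Finset ι := {i | c i ≠ 0}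

theorem mem_activeSet {c : ι → SignType} {i : ι} : i ∈ activeSet c ↔ c i ≠ 0 :=
  Finset.mem_filter_univ i

theorem cubeFace_eq_levelSet_inter (e : ι → ℝ) (c : ι → SignType) :
    cubeFace e c = coordProj (activeSet c) ⁻¹' {coordProj (activeSet c) fun i => c i * e i} ∩
      openSlab e (activeSet c) := by
  ext y
  rw [Set.mem_inter_iff, Set.mem_preimage, Set.mem_singleton_iff, coordProj_eq_iff, cubeFace,
    Set.mem_univ_pi, openSlab, Set.mem_ofPred_eq, ← forall_and]
  refine forall_congr' fun i => ?_
  by_cases hi : c i = 0 <;>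
    simp [hi, mem_activeSet, intervalFace, mem_uIoo_neg_self_iff]

theorem preimage_cubeFace_eq {X : Type*} (F : X → ι → ℝ) (e : ι → ℝ)
    (c : ι → SignType) :
    F ⁻¹' cubeFace e c =
      (coordProj (activeSet c) ∘ F) ⁻¹' {coordProj (activeSet c) fun i => c i * e i} ∩
        F ⁻¹' openSlab e (activeSet c) := by
  rw [cubeFace_eq_levelSet_inter, Set.preimage_inter, Set.preimage_comp]

theorem closure_cubeFace_subset_levelSet :
    closure (cubeFace e c) ⊆
      coordProj (activeSet c) ⁻¹' {coordProj (activeSet c) fun i => c i * e i} := by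
  refine closure_minimal ?_ (isClosed_singleton.preimage (coordProj _).continuous)
  rw [cubeFace_eq_levelSet_inter]
  exact Set.inter_subset_left

theorem mem_cubeFace_of_coordProj_eq {J : Finset ι} {w z : ι → ℝ} (hw : w ∈ cubeFace e c)
    (hJ : activeSet c ⊆ J) (hzw : coordProj J z = coordProj J w) (hz : z ∈ openSlab e J) :
    z ∈ cubeFace e c := by
  intro i _
  by_cases hi : i ∈ J
  · rw [coordProj_eq_iff.1 hzw i hi]
    exact hw i trivial
  · have : c i = 0 := by_contra fun h => hi (hJ (mem_activeSet.2 h))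
    simp only [this, intervalFace_zero, mem_uIoo_neg_self_iff]
    exact hz i hi

end CubeFaces

section Transversality

section Frontier

variable {E ι : Type*} [NormedAddCommGroup E] [NormedSpace ℝ E] [Fintype ι] {F : E → ι → ℝ}
  {e : ι → ℝ} {c : ι → SignType}

/-- Transversality of `F` to the faces of the cube `∏ [-eᵢ, eᵢ]` and to the affine subspaces they
span: at a point where `|Fᵢ| = |eᵢ|` for all `i ∈ I`, the differentials of these `Fᵢ` are linearly
independent. This is the nonexistence of real points on the varieties `Y_{I,σ}`. -/
def IsTransverseToCube (F : E → ι → ℝ) (e : ι → ℝ) : Prop :=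
  ∀ (x : E) (I : Finset ι), (∀ i ∈ I, |F x i| = |e i|) →
    Function.Surjective (coordProj I ∘L fderiv ℝ F x)

theorem IsTransverseToCube.surjective_fderiv_coordProj_comp (h : IsTransverseToCube F e)
    {x : E} (hF : DifferentiableAt ℝ F x) (hx : F x ∈ closure (cubeFace e c)) :
    Function.Surjective (fderiv ℝ (coordProj (activeSet c) ∘ F) x) := by
  rw [((coordProj _).hasFDerivAt.comp x hF.hasFDerivAt).fderiv]
  exact h x _ fun i hi => abs_eq_of_mem_closure_cubeFace hx (mem_activeSet.1 hi)

/- Near `x` only the coordinates `J` with `|Fⱼ x| = |eⱼ|` matter, and `p_J ∘ F` is open at `x`. -/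
theorem IsTransverseToCube.preimage_closure_cubeFace_subset [CompleteSpace E]
    (h : IsTransverseToCube F e) (hF : ContDiff ℝ 1 F) :
    F ⁻¹' closure (cubeFace e c) ⊆ closure (F ⁻¹' cubeFace e c) := by
  classical
  intro x hx
  let J : Finset ι := {i | |F x i| = |e i|}
  have mem_J (i : ι) : i ∈ J ↔ |F x i| = |e i| := Finset.mem_filter_univ i
  have activeSet_subset : activeSet c ⊆ J := fun i hi =>
    (mem_J i).2 (abs_eq_of_mem_closure_cubeFace hx (mem_activeSet.1 hi))
  have mem_openSlab : F x ∈ openSlab e J := fun i hi =>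
    (abs_le_of_mem_closure_cubeFace hx i).lt_of_ne (mt (mem_J i).2 hi)
  have map_nhds : Filter.map (coordProj J ∘ F) (𝓝 x) = 𝓝 (coordProj J (F x)) :=
    ((coordProj J).hasStrictFDerivAt.comp x
      (hF.contDiffAt.hasStrictFDerivAt one_ne_zero)).map_nhds_eq_of_surj
      (LinearMap.range_eq_top.2 (h x J fun i hi => (mem_J i).1 hi))
  have near_face : ∃ᶠ u in 𝓝 (coordProj J (F x)), u ∈ coordProj J '' cubeFace e c :=
    ((coordProj J).continuous.tendsto _).frequently <|
      (mem_closure_iff_frequently.1 hx).mono fun _ => Set.mem_image_of_mem _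
  rw [← map_nhds, Filter.frequently_map] at near_face
  have near_slab : ∀ᶠ z in 𝓝 x, F z ∈ openSlab e J :=
    hF.continuous.continuousAt.eventually_mem ((isOpen_openSlab e J).mem_nhds mem_openSlab)
  refine mem_closure_iff_frequently.2 ((near_face.and_eventually near_slab).mono ?_)
  rintro z ⟨⟨w, hw, hwz⟩, hz⟩
  exact mem_cubeFace_of_coordProj_eq hw activeSet_subset hwz.symm hz

end Frontier

variable {n s : ℕ} {F : EuclideanSpace ℝ (Fin n) → Fin s → ℝ} {e : Fin s → ℝ}
  {c d : Fin s → SignType}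

namespace IsTransverseToCube

theorem isSubmanifold_preimage_cubeFace (h : IsTransverseToCube F e) (hF : ContDiff ℝ ∞ F) :
    IsSubmanifold (F ⁻¹' cubeFace e c) := by
  have surjective_fderiv (x) (hx : x ∈ F ⁻¹' cubeFace e c) :=
    h.surjective_fderiv_coordProj_comp (hF.differentiable (by simp) x) (subset_closure hx)
  rw [preimage_cubeFace_eq] at surjective_fderiv ⊢
  exact isSubmanifold_levelSet_inter ((coordProj _).contDiff.comp hF)
    ((isOpen_openSlab _ _).preimage hF.continuous) surjective_fderiv

theorem whitneyA_preimage_cubeFace (h : IsTransverseToCube F e) (hF : ContDiff ℝ ∞ F) :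
    WhitneyA (F ⁻¹' cubeFace e c) (F ⁻¹' cubeFace e d) := by
  refine whitneyA_of_nonempty_inter_closure fun hne => ?_
  have hd := preimage_cubeFace_subset_preimage_closure hF.continuous hne
  rw [preimage_cubeFace_eq F e c]
  exact whitneyA_levelSet_inter ((coordProj _).contDiff.comp hF)
    ((isOpen_openSlab _ _).preimage hF.continuous)
    (hd.trans (Set.preimage_mono closure_cubeFace_subset_levelSet))
    fun y hy => h.surjective_fderiv_coordProj_comp (hF.differentiable (by simp) y) (hd hy)

theorem whitneyB_preimage_cubeFace (h : IsTransverseToCube F e) (hF : ContDiff ℝ ∞ F) :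
    WhitneyB (F ⁻¹' cubeFace e c) (F ⁻¹' cubeFace e d) := by
  refine whitneyB_of_nonempty_inter_closure fun hne => ?_
  have hd := preimage_cubeFace_subset_preimage_closure hF.continuous hne
  rw [preimage_cubeFace_eq F e c]
  exact whitneyB_levelSet_inter ((coordProj _).contDiff.comp hF)
    ((isOpen_openSlab _ _).preimage hF.continuous)
    (hd.trans (Set.preimage_mono closure_cubeFace_subset_levelSet))
    fun y hy => h.surjective_fderiv_coordProj_comp (hF.differentiable (by simp) y) (hd hy)

theorem isWhitneyStratification (h : IsTransverseToCube F e) (hF : ContDiff ℝ ∞ F) :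
    IsWhitneyStratification (F ⁻¹' hypercube e) ((F ⁻¹' ·) '' facetStratification e) := by
  rw [facetStratification_eq_range, ← Set.range_comp]
  refine
    { sUnion_eq := ?_
      disjoint := ?_
      locallyFinite := fun _ _ =>
        ⟨_, Filter.univ_mem, (Set.finite_range _).subset (Set.sep_subset _ _)⟩
      submanifold := Set.forall_mem_range.2 fun _ => h.isSubmanifold_preimage_cubeFace hF
      frontier := ?_
      whitneyA := ?_
      whitneyB := ?_ }
  · rw [Set.sUnion_range, ← iUnion_cubeFace, Set.preimage_iUnion]
    rfl
  · rintro _ ⟨c, rfl⟩ _ ⟨d, rfl⟩ hne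
    refine Set.disjoint_left.2 fun x hc hd => hne ?_
    exact congrArg (F ⁻¹' ·) (cubeFace_eq_of_mem hc hd)
  · rintro _ ⟨c, rfl⟩ _ ⟨d, rfl⟩ hne
    exact (preimage_cubeFace_subset_preimage_closure hF.continuous hne).trans
      (h.preimage_closure_cubeFace_subset (hF.of_le (by simp)))
  · rintro _ ⟨c, rfl⟩ _ ⟨d, rfl⟩ -
    exact h.whitneyA_preimage_cubeFace hF
  · rintro _ ⟨c, rfl⟩ _ ⟨d, rfl⟩ -
    exact h.whitneyB_preimage_cubeFace hF

end IsTransverseToCube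

variable {f : Fin s → MvPolynomial (Fin n) ℝ}

theorem isTransverseToCube_realMap (h : ∀ I σ, testIdeal f e I σ = ⊤) :
    IsTransverseToCube (realMap f) e := by
  intro x I hI
  have exists_sign (i : I) : ∃ u : ℤˣ, realMap f x i = (u : ℤ) * e i := by
    rcases abs_eq_abs.1 (hI i i.2) with hi | hi
    · exact ⟨1, by simp [hi]⟩
    · exact ⟨-1, by simp [hi]⟩
  choose σ hσ using exists_sign
  by_contra not_surjective
  have le_ker : testIdeal f e I σ ≤
      RingHom.ker (MvPolynomial.aeval (x : Fin n → ℝ) : _ →ₐ[ℝ] ℝ) := by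
    refine testIdeal_le_ker_aeval_iff.2 ⟨hσ, fun surjective => not_surjective fun w => ?_⟩
    obtain ⟨v, hv⟩ := surjective w
    refine ⟨WithLp.toLp 2 v, ?_⟩
    rw [← hv, ContinuousLinearMap.comp_apply, fderiv_realMap_apply]
    rfl
  rw [h, top_le_iff] at le_ker
  exact RingHom.ker_ne_top _ le_ker

theorem isWhitneyStratification_pullback (h : checkWhitneyStratification f e = true) :
    IsWhitneyStratification (thickening f e) (pullbackStratification f e) := by
  rw [thickening_eq_preimage]
  exact (isTransverseToCube_realMap fun I σ => testIdeal_eq_top_iff.2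
    (check_eq_true_iff_forall.1 h I σ)).isWhitneyStratification (contDiff_realMap f)

end Transversality

end CheckWhitney

end

theorem mainTheorem12 (n s : ℕ) (f : Fin s → MvPolynomial (Fin n) ℝ) :
    -- the algorithm returns true for generic `e`, that is, on a nonempty Zariski open set
    (∃ P : MvPolynomial (Fin s) ℝ, P ≠ 0 ∧ ∀ e : Fin s → ℝ,
      MvPolynomial.eval e P ≠ 0 → CheckWhitney.checkWhitneyStratification f e = true) ∧
    -- if it returns true, the pullback is a Whitney stratification
    (∀ e : Fin s → ℝ, CheckWhitney.checkWhitneyStratification f e = true →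
      CheckWhitney.IsWhitneyStratification (CheckWhitney.thickening f e)
        (CheckWhitney.pullbackStratification f e)) ∧
    -- each test of the loop decides whether `Y_{I,σ}` is empty
    (∀ (e : Fin s → ℝ) (I : Finset (Fin s)) (σ : I → ℤˣ),
      CheckWhitney.testIdeal f e I σ = ⊤ ↔ CheckWhitney.badVariety f e I σ = ∅) ∧
    -- the algorithm returns true iff all `Y_{I,σ}` with `#I ≤ n + 1` are empty
    (∀ e : Fin s → ℝ, CheckWhitney.checkWhitneyStratification f e = true ↔
      ∀ (I : Finset (Fin s)) (σ : I → ℤˣ), I.card ≤ n + 1 →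
        CheckWhitney.badVariety f e I σ = ∅) ∧
    -- equivalently, iff all `Y_{I,σ}` are empty
    (∀ e : Fin s → ℝ, CheckWhitney.checkWhitneyStratification f e = true ↔
      ∀ (I : Finset (Fin s)) (σ : I → ℤˣ), CheckWhitney.badVariety f e I σ = ∅) :=
  ⟨CheckWhitney.exists_generic f,
    fun _ => CheckWhitney.isWhitneyStratification_pullback,
    fun _ _ _ => CheckWhitney.testIdeal_eq_top_iff,
    fun _ => CheckWhitney.check_eq_true_iff,
    fun _ => CheckWhitney.check_eq_true_iff_forall⟩
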